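/- For positive integers $2\le k\le n$ let $\mathcal S^n_+$ be the cone of real symmetric positive semidefinite $n\times n$ matrices, let $\mathcal S^{n,k}$ be the set of all real symmetric $n\times n$ matrices all of whose $k\times k$ principal submatrices are positive semidefinite, let $\|\cdot\|_F$ be the Frobenius norm, and put $$\overline{\mathrm{dist}}_F(\mathcal S^{n,k},\mathcal S^n_+)=\sup_{M\in\mathcal S^{n,k},\ \|M\|_F=1}\ \inf_{N\in\mathcal S^n_+}\|M-N\|_F .$$ Theorem. Assume $n\ge 97$ and $\frac{3n}{4}\le k\le n$. Then $$\overline{\mathrm{dist}}_F(\mathcal S^{n,k},\mathcal S^n_+)\le 96\left(\frac{n-k}{n}\right)^{3/2}.$$ -/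

import Mathlib

open scoped Matrix.Norms.Frobenius

noncomputable section

/-- The cone of real symmetric positive semidefinite `n × n` matrices. -/
def psdCone (n : ℕ) : Set (Matrix (Fin n) (Fin n) ℝ) :=
  {X | X.PosSemidef}

/-- The `k`-PSD closure: the real symmetric `n × n` matrices all of whose `k × k` principal
submatrices are positive semidefinite. -/
def kPSDClosure (n k : ℕ) : Set (Matrix (Fin n) (Fin n) ℝ) :=
  {M | M.IsSymm ∧ ∀ J : Finset (Fin n), J.card = k →
    (M.submatrix (fun i : J => (i : Fin n)) (fun i : J => (i : Fin n))).PosSemidef}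

/-- The Frobenius distance `inf_{N ∈ S} ‖M - N‖_F` from a matrix `M` to a set `S` of matrices. -/
def frobeniusDist {n : ℕ} (M : Matrix (Fin n) (Fin n) ℝ) (S : Set (Matrix (Fin n) (Fin n) ℝ)) : ℝ :=
  ⨅ N : S, ‖M - (N : Matrix (Fin n) (Fin n) ℝ)‖

/-- The normalized Frobenius distance between two sets of matrices: the supremum of the Frobenius
distances to `S` of the matrices `M ∈ T` with `‖M‖_F = 1`. -/
def normalizedFrobeniusDist {n : ℕ} (T S : Set (Matrix (Fin n) (Fin n) ℝ)) : ℝ :=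
  sSup {d : ℝ | ∃ M ∈ T, ‖M‖ = 1 ∧ d = frobeniusDist M S}

/-- The infimum in the distance to the PSD cone is a genuine one. -/
theorem frobeniusDist_psdCone_isGLB {n : ℕ} (M : Matrix (Fin n) (Fin n) ℝ) :
    IsGLB (Set.range fun N : psdCone n => ‖M - (N : Matrix (Fin n) (Fin n) ℝ)‖)
      (frobeniusDist M (psdCone n)) := by
  have : Nonempty (psdCone n) := ⟨⟨0, Matrix.PosSemidef.zero⟩⟩
  exact isGLB_ciInf ⟨0, by rintro _ ⟨N, rfl⟩; exact norm_nonneg _⟩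

/-- The supremum in the normalized distance from the `k`-PSD closure to the PSD cone is a genuine
one: it is over a non-empty bounded set. -/
theorem normalizedFrobeniusDist_isLUB {n : ℕ} (hn : 1 ≤ n) (k : ℕ) :
    IsLUB {d : ℝ | ∃ M ∈ kPSDClosure n k, ‖M‖ = 1 ∧ d = frobeniusDist M (psdCone n)}
      (normalizedFrobeniusDist (kPSDClosure n k) (psdCone n)) := by
  apply isLUB_csSup
  · have hne : (1 : Matrix (Fin n) (Fin n) ℝ) ≠ 0 := by
      have : Nonempty (Fin n) := ⟨⟨0, hn⟩⟩
      exact one_ne_zero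
    have hpsd : (‖(1 : Matrix (Fin n) (Fin n) ℝ)‖⁻¹ • (1 : Matrix (Fin n) (Fin n) ℝ)).PosSemidef :=
      Matrix.PosSemidef.one.smul (inv_nonneg.2 (norm_nonneg _))
    refine ⟨_, ‖(1 : Matrix (Fin n) (Fin n) ℝ)‖⁻¹ • 1, ⟨?_, fun J _ => hpsd.submatrix _⟩, ?_, rfl⟩
    · simp [Matrix.IsSymm]
    · rw [norm_smul, norm_inv, norm_norm, inv_mul_cancel₀ (norm_ne_zero_iff.2 hne)]
  · refine ⟨1, ?_⟩
    rintro _ ⟨M, -, hM, rfl⟩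
    have := (frobeniusDist_psdCone_isGLB M).1 ⟨⟨0, Matrix.PosSemidef.zero⟩, rfl⟩
    simpa [hM] using this

end

/-!
Write `M = P - N` with `P`, `N` positive semidefinite and `P * N = 0`. The distance from `M` to the
cone is at most `‖N‖`, and `N` has rank at most `r = n - k` because its range contains no nonzero
vector supported on `k` coordinates. Hence `(tr N)² ≤ r ‖N‖²`, and on a set `L` of at least half of
the coordinates the diagonal entries of `N` are at most twice their average.

Delete `r` uniformly random coordinates of `L` and rescale the other coordinates of `L` by a
diagonal matrix `D` of mean `1`. The matrix `D * M * D` is positive semidefinite, so by the Schur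
product theorem its pairing with `N` is nonnegative. Averaging turns this pairing into
`⟨N, M⟩ = -‖N‖²` plus a correction supported on the `L × L` block, which is essentially at most
`(r / n) ∑ i ∈ L, N i i * P i i` up to a constant. By Cauchy–Schwarz and the smallness of the
entries `N i i`, the sum is at most of order `(r / n)^(1/2) ‖N‖ ‖P‖`, so `‖N‖` is at most of order
`(r / n)^(3/2) ‖P‖`.
-/

open Finset Matrix
open scoped BigOperators ComplexOrder

section Frobenius

variable {m n : Type*} [Fintype m] [Fintype n]

theorem frobenius_norm_sq_eq_sum (A : Matrix m n ℝ) : ‖A‖ ^ 2 = ∑ i, ∑ j, A i j ^ 2 := by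
  rw [frobenius_norm_def, ← Real.sqrt_eq_rpow, Real.sq_sqrt (by positivity)]
  simp

theorem frobenius_norm_sq_eq_trace (A : Matrix m n ℝ) : ‖A‖ ^ 2 = (A * Aᵀ).trace := by
  rw [frobenius_norm_sq_eq_sum, ← sum_hadamard_eq]
  simp only [hadamard_apply, sq]

theorem frobenius_norm_sub_sq {A B : Matrix m n ℝ} (h : (A * Bᵀ).trace = 0) :
    ‖A - B‖ ^ 2 = ‖A‖ ^ 2 + ‖B‖ ^ 2 := by
  have h' : (B * Aᵀ).trace = 0 := by rw [← trace_transpose, transpose_mul, transpose_transpose, h]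
  simp only [frobenius_norm_sq_eq_trace, transpose_sub, Matrix.sub_mul, Matrix.mul_sub, trace_sub,
    h, h']
  ring

theorem sum_sum_sq_le_frobenius_norm_sq (A : Matrix m n ℝ) (s : Finset m) (t : Finset n) :
    ∑ i ∈ s, ∑ j ∈ t, A i j ^ 2 ≤ ‖A‖ ^ 2 := by
  rw [frobenius_norm_sq_eq_sum]
  calc ∑ i ∈ s, ∑ j ∈ t, A i j ^ 2
      ≤ ∑ i ∈ s, ∑ j, A i j ^ 2 := sum_le_sum fun i _ =>
        sum_le_sum_of_subset_of_nonneg (subset_univ t) fun j _ _ => sq_nonneg _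
    _ ≤ ∑ i, ∑ j, A i j ^ 2 :=
        sum_le_sum_of_subset_of_nonneg (subset_univ s) fun i _ _ => by positivity

theorem sum_diag_sq_le_frobenius_norm_sq (A : Matrix n n ℝ) (s : Finset n) :
    ∑ i ∈ s, A i i ^ 2 ≤ ‖A‖ ^ 2 := by
  refine le_trans ?_ (sum_sum_sq_le_frobenius_norm_sq A s s)
  exact sum_le_sum fun i hi => single_le_sum (f := fun j => A i j ^ 2) (fun j _ => sq_nonneg _) hi

end Frobenius

theorem sum_sum_hadamard_nonneg {ι 𝕜 : Type*} [RCLike 𝕜] {A B : Matrix ι ι 𝕜}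
    (hA : A.PosSemidef) (hB : B.PosSemidef) (s : Finset ι) :
    0 ≤ ∑ i ∈ s, ∑ j ∈ s, (A ⊙ B) i j := by
  have h := ((hA.submatrix ((↑) : s → ι)).hadamard (hB.submatrix (↑))).dotProduct_mulVec_nonneg 1
  simpa only [dotProduct, mulVec, hadamard_apply, submatrix_apply, star_one, Pi.one_apply, one_mul,
    mul_one, ← sum_coe_sort s] using h

section PosSemidef

variable {ι 𝕜 : Type*} [Fintype ι] [RCLike 𝕜]

open scoped MatrixOrder in
theorem exists_posSemidef_sub_posSemidef_mul_eq_zero {M : Matrix ι ι 𝕜} (hM : M.IsHermitian) :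
    ∃ P N : Matrix ι ι 𝕜, P.PosSemidef ∧ N.PosSemidef ∧ M = P - N ∧ P * N = 0 := by
  classical
  exact ⟨M⁺, M⁻, (CFC.posPart_nonneg M).posSemidef, (CFC.negPart_nonneg M).posSemidef,
    (CFC.posPart_sub_negPart M hM).symm, CFC.posPart_mul_negPart M⟩

theorem trace_mul_self_eq_sum_eigenvalues_sq [DecidableEq ι] {A : Matrix ι ι 𝕜}
    (hA : A.IsHermitian) : (A * A).trace = ∑ i, (hA.eigenvalues i : 𝕜) ^ 2 := by
  conv_lhs => rw [hA.spectral_theorem, ← map_mul, Unitary.conjStarAlgAut_apply, trace_mul_cycle,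
    Unitary.coe_star_mul_self, Matrix.one_mul, diagonal_mul_diagonal, trace_diagonal]
  simp only [Function.comp_apply, sq]

theorem trace_sq_le_rank_mul_frobenius_norm_sq {A : Matrix ι ι ℝ} (hA : A.IsHermitian) :
    A.trace ^ 2 ≤ A.rank * ‖A‖ ^ 2 := by
  classical
  have hAt : Aᵀ = A := (conjTranspose_eq_transpose_of_trivial A).symm.trans hA.eq
  have htrace : A.trace = ∑ i with hA.eigenvalues i ≠ 0, hA.eigenvalues i := by
    rw [sum_filter_ne_zero, hA.trace_eq_sum_eigenvalues]
    rfl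
  have hrank : A.rank = #{i | hA.eigenvalues i ≠ 0} := by
    rw [hA.rank_eq_card_non_zero_eigs, Fintype.card_subtype]
  rw [frobenius_norm_sq_eq_trace, hAt, trace_mul_self_eq_sum_eigenvalues_sq hA, htrace, hrank]
  refine sq_sum_le_card_mul_sum_sq.trans ?_
  gcongr
  exact sum_le_sum_of_subset_of_nonneg (subset_univ _) fun i _ _ => sq_nonneg _

end PosSemidef

section PrincipalSubmatrix

variable {ι 𝕜 : Type*} [Fintype ι] [RCLike 𝕜] {J : Finset ι}

theorem dotProduct_mulVec_nonneg_of_posSemidef_submatrix {M : Matrix ι ι 𝕜}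
    (hM : (M.submatrix (fun i : J => (i : ι)) (fun i : J => (i : ι))).PosSemidef) {x : ι → 𝕜}
    (hx : ∀ i ∉ J, x i = 0) : 0 ≤ star x ⬝ᵥ (M *ᵥ x) := by
  have hsum (f : ι → 𝕜) (hf : ∀ i ∉ J, f i = 0) : ∑ i : J, f i = ∑ i, f i := by
    rw [sum_coe_sort J f]
    exact sum_subset (subset_univ _) fun i _ hi => hf i hi
  refine (hM.dotProduct_mulVec_nonneg fun i : J => x i).trans_eq ?_
  simp only [dotProduct, mulVec, submatrix_apply, Pi.star_apply]
  rw [← hsum _ fun i hi => by rw [hx i hi, star_zero, zero_mul]]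
  refine sum_congr rfl fun i _ => ?_
  rw [hsum (fun j => M i j * x j) fun j hj => by rw [hx j hj, mul_zero]]

-- Restriction to `Jᶜ` is injective on the range of `N`: if `N y` is supported on `J`, then
-- `P (N y) = 0` and positivity of `P - N` on `J` make `N y` isotropic for `N`, so `N (N y) = 0`.
theorem rank_le_card_compl_of_posSemidef_submatrix_sub [DecidableEq ι] {P N : Matrix ι ι 𝕜}
    (hN : N.PosSemidef) (hPN : P * N = 0)
    (h : ((P - N).submatrix (fun i : J => (i : ι)) (fun i : J => (i : ι))).PosSemidef) :
    N.rank ≤ #Jᶜ := by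
  let restrict : LinearMap.range N.mulVecLin →ₗ[𝕜] ((Jᶜ : Finset ι) → 𝕜) :=
    (LinearMap.funLeft 𝕜 𝕜 ((↑) : (Jᶜ : Finset ι) → ι)).domRestrict _
  suffices hinj : Function.Injective restrict by
    exact (LinearMap.finrank_le_finrank_of_injective hinj).trans_eq
      (by rw [Module.finrank_fintype_fun_eq_card, Fintype.card_coe])
  rw [injective_iff_map_eq_zero]
  rintro ⟨_, y, rfl⟩ hy
  have hsupp : ∀ i ∉ J, (N *ᵥ y) i = 0 := fun i hi => congrFun hy ⟨i, mem_compl.2 hi⟩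
  have hform : star (N *ᵥ y) ⬝ᵥ (N *ᵥ (N *ᵥ y)) = 0 := by
    refine le_antisymm ?_ (hN.dotProduct_mulVec_nonneg _)
    have hnonneg := dotProduct_mulVec_nonneg_of_posSemidef_submatrix h hsupp
    have hP : P *ᵥ (N *ᵥ y) = 0 := by rw [mulVec_mulVec, hPN, zero_mulVec]
    rwa [sub_mulVec, hP, zero_sub, dotProduct_neg, neg_nonneg] at hnonneg
  have hNNy : (Nᴴ * N) *ᵥ y = 0 := by
    rw [hN.isHermitian.eq, ← mulVec_mulVec, ← hN.dotProduct_mulVec_zero_iff, hform]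
  exact Subtype.ext ((conjTranspose_mul_self_mulVec_eq_zero N y).1 hNNy)

theorem dotProduct_hadamard_mulVec_nonneg {M N : Matrix ι ι 𝕜}
    (hM : (M.submatrix (fun i : J => (i : ι)) (fun i : J => (i : ι))).PosSemidef)
    (hN : N.PosSemidef) {x : ι → 𝕜} (hx : ∀ i ∉ J, x i = 0) :
    0 ≤ star x ⬝ᵥ ((N ⊙ M) *ᵥ x) :=
  dotProduct_mulVec_nonneg_of_posSemidef_submatrix (M := N ⊙ M) ((hN.submatrix _).hadamard hM) hx

end PrincipalSubmatrix

section Sampling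

variable {ι : Type*} [DecidableEq ι] {L : Finset ι} {s : ℕ}

theorem expect_powersetCard_ite_subset {T : Finset ι} (hT : T ⊆ L) (hs : s ≤ #L) :
    𝔼 K ∈ L.powersetCard s, (if T ⊆ K then (1 : ℝ) else 0) = s.choose #T / (#L).choose #T := by
  have hcard : #{K ∈ L.powersetCard s | T ⊆ K} * (#L).choose #T
      = s.choose #T * (#L).choose s := by
    rcases le_or_gt #T s with hTs | hTs
    · rw [card_filter_powersetCard_subset T L s hT hTs, mul_comm, ← Nat.choose_mul hTs, mul_comm]
    · rw [Nat.choose_eq_zero_of_lt hTs, zero_mul, filter_eq_empty_iff.2, card_empty, zero_mul]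
      intro K hK hTK
      have := card_le_card hTK
      rw [(mem_powersetCard.1 hK).2] at this
      omega
  have hs' : ((#L).choose s : ℝ) ≠ 0 := by exact_mod_cast (Nat.choose_pos hs).ne'
  have hT' : ((#L).choose #T : ℝ) ≠ 0 := by exact_mod_cast (Nat.choose_pos (card_le_card hT)).ne'
  rw [expect_eq_sum_div_card, sum_boole, card_powersetCard, div_eq_div_iff hs' hT']
  exact_mod_cast hcard

/-- The diagonal of the random compression by a sample `K ⊆ L`: the coordinates outside `L` are
kept, those in `L` are kept only on `K`, rescaled so that each weight has mean `1` when `K` is a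
uniformly random subset of `L` of given positive size. -/
noncomputable def samplingWeight (L K : Finset ι) (i : ι) : ℝ :=
  if i ∈ L then (if i ∈ K then #L / #K else 0) else 1

theorem samplingWeight_of_notMem {i : ι} (hi : i ∉ L) (K : Finset ι) :
    samplingWeight L K i = 1 :=
  if_neg hi

theorem samplingWeight_of_mem_of_notMem {K : Finset ι} {i : ι} (hi : i ∈ L) (hiK : i ∉ K) :
    samplingWeight L K i = 0 := by
  rw [samplingWeight, if_pos hi, if_neg hiK]

theorem expect_samplingWeight (hs0 : 0 < s) (hs : s ≤ #L) (i : ι) :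
    𝔼 K ∈ L.powersetCard s, samplingWeight L K i = 1 := by
  by_cases hi : i ∈ L
  · have hterm : ∀ K ∈ L.powersetCard s,
        samplingWeight L K i = #L / s * (if {i} ⊆ K then 1 else 0) := fun K hK => by
      simp [samplingWeight, hi, (mem_powersetCard.1 hK).2]
    have hL : (#L : ℝ) ≠ 0 := by exact_mod_cast (hs0.trans_le hs).ne'
    have hs' : (s : ℝ) ≠ 0 := by exact_mod_cast hs0.ne'
    rw [expect_congr rfl hterm, ← mul_expect,
      expect_powersetCard_ite_subset (singleton_subset_iff.2 hi) hs, card_singleton,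
      Nat.choose_one_right, Nat.choose_one_right]
    field_simp
  · simp only [samplingWeight_of_notMem hi]
    exact expect_const (powersetCard_nonempty.2 hs) 1

theorem expect_samplingWeight_mul_of_mem {i j : ι} (hi : i ∈ L) (hj : j ∈ L) (hs : s ≤ #L) :
    𝔼 K ∈ L.powersetCard s, samplingWeight L K i * samplingWeight L K j
      = (#L / s : ℝ) ^ 2 * (s.choose #{i, j} / (#L).choose #{i, j}) := by
  have hterm : ∀ K ∈ L.powersetCard s, samplingWeight L K i * samplingWeight L K j
      = (#L / s : ℝ) ^ 2 * (if {i, j} ⊆ K then 1 else 0) := fun K hK => by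
    by_cases hiK : i ∈ K <;> by_cases hjK : j ∈ K <;>
      simp [samplingWeight, insert_subset_iff, hi, hj, hiK, hjK, (mem_powersetCard.1 hK).2, sq]
  rw [expect_congr rfl hterm, ← mul_expect,
    expect_powersetCard_ite_subset (insert_subset hi (singleton_subset_iff.2 hj)) hs]

-- For `#L = 1` the denominator vanishes; then `s = 1` and the correction is indeed `0`.
theorem expect_samplingWeight_mul (hs0 : 0 < s) (hs : s ≤ #L) (i j : ι) :
    𝔼 K ∈ L.powersetCard s, samplingWeight L K i * samplingWeight L K j
      = 1 + (#L - s) / (s * (#L - 1)) *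
          (if i ∈ L ∧ j ∈ L then (if i = j then (#L : ℝ) else 0) - 1 else 0) := by
  by_cases hi : i ∈ L
  swap
  · simp only [samplingWeight_of_notMem hi, one_mul, expect_samplingWeight hs0 hs, hi, false_and,
      if_false, mul_zero, add_zero]
  by_cases hj : j ∈ L
  swap
  · simp only [samplingWeight_of_notMem hj, mul_one, expect_samplingWeight hs0 hs, hj, and_false,
      if_false, mul_zero, add_zero]
  have hs' : (s : ℝ) ≠ 0 := by exact_mod_cast hs0.ne'
  rw [expect_samplingWeight_mul_of_mem hi hj hs, if_pos ⟨hi, hj⟩]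
  rcases eq_or_ne i j with rfl | hij
  · rw [pair_eq_singleton, card_singleton, Nat.choose_one_right, Nat.choose_one_right, if_pos rfl]
    rcases (show 1 ≤ #L by omega).eq_or_lt with hL1 | hL1
    · obtain rfl : s = 1 := by omega
      simp [← hL1]
    · have hL1' : (#L : ℝ) - 1 ≠ 0 := sub_ne_zero.2 (by exact_mod_cast hL1.ne')
      field_simp
      ring
  · have hL1 : 1 < #L := one_lt_card.2 ⟨i, hi, j, hj, hij⟩
    have hL1' : (#L : ℝ) - 1 ≠ 0 := sub_ne_zero.2 (by exact_mod_cast hL1.ne')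
    rw [card_pair hij, Nat.cast_choose_two, Nat.cast_choose_two, if_neg hij]
    field_simp
    ring

theorem expect_samplingWeight_dotProduct_mulVec [Fintype ι] (hs0 : 0 < s) (hs : s ≤ #L)
    (F : Matrix ι ι ℝ) :
    𝔼 K ∈ L.powersetCard s, samplingWeight L K ⬝ᵥ (F *ᵥ samplingWeight L K)
      = ∑ i, ∑ j, F i j + (#L - s) / (s * (#L - 1)) *
          (#L * ∑ i ∈ L, F i i - ∑ i ∈ L, ∑ j ∈ L, F i j) := by
  have hform (w : ι → ℝ) : w ⬝ᵥ (F *ᵥ w) = ∑ i, ∑ j, w i * w j * F i j := by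
    simp only [dotProduct, mulVec, mul_sum]
    exact sum_congr rfl fun i _ => sum_congr rfl fun j _ => by ring
  have hcorr : #L * ∑ i ∈ L, F i i - ∑ i ∈ L, ∑ j ∈ L, F i j
      = ∑ i, ∑ j, (if i ∈ L ∧ j ∈ L then (if i = j then (#L : ℝ) else 0) - 1 else 0) * F i j := by
    simp [ite_and, sub_mul, mul_sum]
  rw [hcorr]
  simp only [hform, expect_sum_comm, ← expect_mul, expect_samplingWeight_mul hs0 hs, mul_sum,
    ← sum_add_distrib]
  exact sum_congr rfl fun i _ => sum_congr rfl fun j _ => by ring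

end Sampling

section LightCoordinates

variable {ι : Type*} [Fintype ι] {f : ι → ℝ}

theorem card_le_two_mul_card_filter_le_two_mul_average (hf : ∀ i, 0 ≤ f i) :
    Fintype.card ι ≤ 2 * #{i | f i ≤ 2 / Fintype.card ι * ∑ j, f j} := by
  classical
  set c : ℝ := 2 / Fintype.card ι * ∑ j, f j
  have hsum_nonneg : 0 ≤ ∑ j, f j := sum_nonneg fun i _ => hf i
  suffices hheavy : 2 * #{i | ¬ f i ≤ c} ≤ Fintype.card ι by
    have := card_filter_add_card_filter_not (s := univ) fun i => f i ≤ c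
    rw [card_univ] at this
    omega
  by_contra hlt
  rw [not_le] at hlt
  have hne : ({i | ¬ f i ≤ c} : Finset ι).Nonempty := card_pos.1 (by omega)
  have : Nonempty ι := hne.to_subtype.map (↑)
  have hhalf : (Fintype.card ι : ℝ) ≤ 2 * #{i | ¬ f i ≤ c} := by exact_mod_cast hlt.le
  refine lt_irrefl (∑ j, f j) ?_
  calc ∑ j, f j = Fintype.card ι / 2 * c := by simp only [c]; field_simp
    _ ≤ #{i | ¬ f i ≤ c} * c := by gcongr; linarith
    _ = ∑ i with ¬ f i ≤ c, c := by rw [sum_const, nsmul_eq_mul]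
    _ < ∑ i with ¬ f i ≤ c, f i :=
        sum_lt_sum_of_nonempty hne fun i hi => not_le.1 (mem_filter.1 hi).2
    _ ≤ ∑ j, f j := sum_le_sum_of_subset_of_nonneg (subset_univ _) fun i _ _ => hf i

theorem exists_finset_sum_sq_le (hf : ∀ i, 0 ≤ f i) :
    ∃ L : Finset ι, Fintype.card ι ≤ 2 * #L ∧
      ∑ i ∈ L, f i ^ 2 ≤ 2 / Fintype.card ι * (∑ i, f i) ^ 2 := by
  classical
  refine ⟨_, card_le_two_mul_card_filter_le_two_mul_average hf, ?_⟩
  set c : ℝ := 2 / Fintype.card ι * ∑ j, f j with hc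
  have hc0 : 0 ≤ c := mul_nonneg (by positivity) (sum_nonneg fun i _ => hf i)
  calc ∑ i with f i ≤ c, f i ^ 2
      ≤ ∑ i with f i ≤ c, c * f i := sum_le_sum fun i hi => by
        rw [sq]
        exact mul_le_mul_of_nonneg_right (mem_filter.1 hi).2 (hf i)
    _ = c * ∑ i with f i ≤ c, f i := by rw [mul_sum]
    _ ≤ c * ∑ i, f i := by
        gcongr
        exacts [fun i _ _ => hf i, subset_univ _]
    _ = 2 / Fintype.card ι * (∑ i, f i) ^ 2 := by rw [hc]; ring

end LightCoordinates

section NegativePart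

variable {ι : Type*} [Fintype ι] [DecidableEq ι] {L : Finset ι} {s : ℕ}

theorem sum_hadamard_nonneg_of_posSemidef_submatrix {M N : Matrix ι ι ℝ} (hs0 : 0 < s)
    (hs : s ≤ #L)
    (hM : ∀ K ⊆ L, #K = s → (M.submatrix (fun i : (K ∪ Lᶜ : Finset ι) => (i : ι))
      (fun i : (K ∪ Lᶜ : Finset ι) => (i : ι))).PosSemidef)
    (hN : N.PosSemidef) :
    0 ≤ ∑ i, ∑ j, (N ⊙ M) i j + (#L - s) / (s * (#L - 1)) *
      (#L * ∑ i ∈ L, (N ⊙ M) i i - ∑ i ∈ L, ∑ j ∈ L, (N ⊙ M) i j) := by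
  rw [← expect_samplingWeight_dotProduct_mulVec hs0 hs]
  refine expect_nonneg fun K hK => ?_
  obtain ⟨hKL, hKs⟩ := mem_powersetCard.1 hK
  refine dotProduct_hadamard_mulVec_nonneg (hM K hKL hKs) hN fun i hi => ?_
  rw [mem_union, mem_compl, not_or, not_not] at hi
  exact samplingWeight_of_mem_of_notMem hi.2 hi.1

theorem frobenius_norm_sq_le_of_posSemidef_submatrix_sub {P N : Matrix ι ι ℝ} (hP : P.PosSemidef)
    (hN : N.PosSemidef) (hPN : P * N = 0) (hs0 : 0 < s) (hs : s ≤ #L)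
    (h : ∀ K ⊆ L, #K = s → ((P - N).submatrix (fun i : (K ∪ Lᶜ : Finset ι) => (i : ι))
      (fun i : (K ∪ Lᶜ : Finset ι) => (i : ι))).PosSemidef) :
    ‖N‖ ^ 2 ≤ (#L - s) / (s * (#L - 1)) * (#L * ∑ i ∈ L, N i i * P i i + ‖N‖ ^ 2) := by
  have havg := sum_hadamard_nonneg_of_posSemidef_submatrix hs0 hs h hN
  have hsub (i j : ι) : (N ⊙ (P - N)) i j = (N ⊙ P) i j - N i j ^ 2 := by
    rw [hadamard_apply, hadamard_apply, Matrix.sub_apply]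
    ring
  have htotal : ∑ i, ∑ j, (N ⊙ (P - N)) i j = -‖N‖ ^ 2 := by
    have : ∑ i, ∑ j, (N ⊙ P) i j = 0 := by
      rw [hadamard_comm, sum_hadamard_eq, ← conjTranspose_eq_transpose_of_trivial, hN.isHermitian,
        hPN, trace_zero]
    simp only [hsub, sum_sub_distrib, this, ← frobenius_norm_sq_eq_sum, zero_sub]
  have hblock : -‖N‖ ^ 2 ≤ ∑ i ∈ L, ∑ j ∈ L, (N ⊙ (P - N)) i j := by
    simp only [hsub, sum_sub_distrib]
    linarith [sum_sum_hadamard_nonneg hN hP L, sum_sum_sq_le_frobenius_norm_sq N L L]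
  have hdiag : ∑ i ∈ L, (N ⊙ (P - N)) i i ≤ ∑ i ∈ L, N i i * P i i :=
    sum_le_sum fun i _ => by
      rw [hsub, hadamard_apply]
      exact sub_le_self _ (sq_nonneg _)
  have hs' : (0 : ℝ) ≤ #L - s := sub_nonneg.2 (by exact_mod_cast hs)
  have hL : (0 : ℝ) ≤ #L - 1 := sub_nonneg.2 (by exact_mod_cast hs0.trans_le hs)
  rw [htotal, neg_add_eq_sub, sub_nonneg] at havg
  refine havg.trans ?_
  gcongr
  linarith [mul_le_mul_of_nonneg_left hdiag (Nat.cast_nonneg (α := ℝ) #L)]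

theorem sub_one_mul_frobenius_norm_sq_le {P N : Matrix ι ι ℝ} (hP : P.PosSemidef)
    (hN : N.PosSemidef) (hPN : P * N = 0) (hs0 : 0 < s) (hs : s ≤ #L)
    (h : ∀ K ⊆ L, #K = s → ((P - N).submatrix (fun i : (K ∪ Lᶜ : Finset ι) => (i : ι))
      (fun i : (K ∪ Lᶜ : Finset ι) => (i : ι))).PosSemidef) :
    (s - 1) * ‖N‖ ^ 2 ≤ (#L - s) * ∑ i ∈ L, N i i * P i i := by
  have hbound := frobenius_norm_sq_le_of_posSemidef_submatrix_sub hP hN hPN hs0 hs h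
  rcases (show 1 ≤ #L by omega).eq_or_lt with hL1 | hL1
  · obtain rfl : s = 1 := by omega
    simp [← hL1]
  have hL : (1 : ℝ) < #L := by exact_mod_cast hL1
  have hs0' : (0 : ℝ) < s := by exact_mod_cast hs0
  rw [div_mul_eq_mul_div, le_div_iff₀ (mul_pos hs0' (sub_pos.2 hL))] at hbound
  refine le_of_mul_le_mul_left ?_ (zero_lt_one.trans hL)
  linarith

theorem sub_one_sq_mul_frobenius_norm_sq_le {P N : Matrix ι ι ℝ} {c : ℝ} (hP : P.PosSemidef)
    (hN : N.PosSemidef) (hPN : P * N = 0) (hs0 : 0 < s) (hs : s ≤ #L)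
    (h : ∀ K ⊆ L, #K = s → ((P - N).submatrix (fun i : (K ∪ Lᶜ : Finset ι) => (i : ι))
      (fun i : (K ∪ Lᶜ : Finset ι) => (i : ι))).PosSemidef)
    (hc : 0 ≤ c) (hL : ∑ i ∈ L, N i i ^ 2 ≤ c * N.trace ^ 2) :
    (s - 1) ^ 2 * ‖N‖ ^ 2 ≤ c * (#L - s) ^ 3 * ‖P‖ ^ 2 := by
  have hr : (0 : ℝ) ≤ #L - s := sub_nonneg.2 (by exact_mod_cast hs)
  rcases eq_or_ne N 0 with rfl | hN0
  · rw [norm_zero, zero_pow two_ne_zero, mul_zero]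
    positivity
  have hS : 0 < ‖N‖ ^ 2 := pow_pos (norm_pos_iff.2 hN0) 2
  obtain ⟨K, hKL, hKs⟩ := exists_subset_card_eq hs
  have hrank : (N.rank : ℝ) ≤ #L - s := by
    have hcompl : #(K ∪ Lᶜ)ᶜ = #L - s := by
      rw [compl_union, compl_compl, inter_comm, ← sdiff_eq_inter_compl, card_sdiff_of_subset hKL,
        hKs]
    rw [← Nat.cast_sub hs, ← hcompl]
    exact_mod_cast rank_le_card_compl_of_posSemidef_submatrix_sub hN hPN (h K hKL hKs)
  have hs1 : (0 : ℝ) ≤ s - 1 := sub_nonneg.2 (by exact_mod_cast hs0)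
  refine le_of_mul_le_mul_right ?_ hS
  calc (s - 1) ^ 2 * ‖N‖ ^ 2 * ‖N‖ ^ 2
      = ((s - 1) * ‖N‖ ^ 2) ^ 2 := by ring
    _ ≤ ((#L - s) * ∑ i ∈ L, N i i * P i i) ^ 2 := by
        exact pow_le_pow_left₀ (mul_nonneg hs1 hS.le)
          (sub_one_mul_frobenius_norm_sq_le hP hN hPN hs0 hs h) 2
    _ = (#L - s) ^ 2 * (∑ i ∈ L, N i i * P i i) ^ 2 := mul_pow _ _ _
    _ ≤ (#L - s) ^ 2 * ((∑ i ∈ L, N i i ^ 2) * ∑ i ∈ L, P i i ^ 2) := by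
        gcongr
        exact sum_mul_sq_le_sq_mul_sq _ _ _
    _ ≤ (#L - s) ^ 2 * (c * ((#L - s) * ‖N‖ ^ 2) * ‖P‖ ^ 2) := by
        gcongr
        · exact hL.trans <| mul_le_mul_of_nonneg_left
            ((trace_sq_le_rank_mul_frobenius_norm_sq hN.isHermitian).trans (by gcongr)) hc
        · exact sum_diag_sq_le_frobenius_norm_sq P L
    _ = c * (#L - s) ^ 3 * ‖P‖ ^ 2 * ‖N‖ ^ 2 := by ring

end NegativePart

section KPSDClosure

variable {n k : ℕ} {P N : Matrix (Fin n) (Fin n) ℝ}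

theorem frobenius_norm_sq_le_of_sub_mem_kPSDClosure_of_lt (hP : P.PosSemidef) (hN : N.PosSemidef)
    (hPN : P * N = 0) (hkn : k < n) (hε : 6 * ((n : ℝ) - k) < n) (h : P - N ∈ kPSDClosure n k) :
    ‖N‖ ^ 2 ≤ 72 * (((n : ℝ) - k) / n) ^ 3 * ‖P‖ ^ 2 := by
  have hn : (0 : ℝ) < n := by exact_mod_cast Nat.zero_lt_of_lt hkn
  have hr : (1 : ℝ) ≤ n - k := by
    rw [le_sub_iff_add_le']
    exact_mod_cast hkn
  obtain ⟨L, hcard, hlight⟩ := exists_finset_sum_sq_le fun i => hN.diag_nonneg (i := i)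
  rw [Fintype.card_fin] at hcard hlight
  have hL : (n : ℝ) ≤ 2 * #L := by exact_mod_cast hcard
  have hs : ((#L + k - n : ℕ) : ℝ) = #L - (n - k) := by
    have : n ≤ #L + k := by
      have : (n : ℝ) ≤ #L + k := by linarith
      exact_mod_cast this
    push_cast [this]
    ring
  have hs0 : 0 < #L + k - n := by
    have : (0 : ℝ) < (#L + k - n : ℕ) := by linarith
    exact_mod_cast this
  have hmain := sub_one_sq_mul_frobenius_norm_sq_le (s := #L + k - n) (c := 2 / n) hP hN hPN hs0
    (by omega)
    (fun K hKL hK => h.2 _ <| by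
      rw [card_union_of_disjoint (disjoint_compl_right.mono_left hKL), card_compl,
        Fintype.card_fin, hK]
      have := card_le_univ L
      rw [Fintype.card_fin] at this
      omega)
    (by positivity) hlight
  rw [hs, sub_sub_cancel] at hmain
  have hsize : (n : ℝ) / 6 ≤ #L - (n - k) - 1 := by linarith
  have hsq : ((n : ℝ) / 6) ^ 2 * ‖N‖ ^ 2 ≤ 2 / n * (n - k) ^ 3 * ‖P‖ ^ 2 :=
    le_trans (by gcongr) hmain
  refine le_of_mul_le_mul_left (hsq.trans_eq ?_) (by positivity : (0 : ℝ) < (n / 6) ^ 2)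
  field_simp
  ring

theorem eq_zero_of_sub_mem_kPSDClosure_self (hN : N.PosSemidef) (hPN : P * N = 0)
    (h : P - N ∈ kPSDClosure n n) : N = 0 := by
  have hrank := rank_le_card_compl_of_posSemidef_submatrix_sub hN hPN (h.2 univ (card_fin n))
  rw [compl_univ, card_empty, Nat.le_zero] at hrank
  have htrace := trace_sq_le_rank_mul_frobenius_norm_sq hN.isHermitian
  rw [hrank, Nat.cast_zero, zero_mul] at htrace
  exact hN.trace_eq_zero_iff.1 (pow_eq_zero_iff two_ne_zero |>.1 (htrace.antisymm (sq_nonneg _)))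

theorem frobenius_norm_sq_le_of_sub_mem_kPSDClosure (hP : P.PosSemidef) (hN : N.PosSemidef)
    (hPN : P * N = 0) (hkn : k ≤ n) (h : P - N ∈ kPSDClosure n k) :
    ‖N‖ ^ 2 ≤ (6 * (((n : ℝ) - k) / n)) ^ 3 * ‖P - N‖ ^ 2 := by
  have hpyth : ‖P - N‖ ^ 2 = ‖P‖ ^ 2 + ‖N‖ ^ 2 := frobenius_norm_sub_sq <| by
    rw [← conjTranspose_eq_transpose_of_trivial, hN.isHermitian, hPN, trace_zero]
  rcases hkn.eq_or_lt with rfl | hlt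
  · simp [eq_zero_of_sub_mem_kPSDClosure_self hN hPN h]
  have hε : 0 ≤ ((n : ℝ) - k) / n := by
    have : (k : ℝ) ≤ n := by exact_mod_cast hkn
    exact div_nonneg (sub_nonneg.2 this) n.cast_nonneg
  have hn : (0 : ℝ) < n := by exact_mod_cast Nat.zero_lt_of_lt hlt
  rcases lt_or_ge (6 * ((n : ℝ) - k)) n with hsmall | hlarge
  · have := frobenius_norm_sq_le_of_sub_mem_kPSDClosure_of_lt hP hN hPN hlt hsmall h
    refine this.trans ?_
    rw [mul_pow, hpyth]
    gcongr
    · norm_num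
    · exact le_add_of_nonneg_right (sq_nonneg _)
  · have : 1 ≤ 6 * (((n : ℝ) - k) / n) := by rwa [← mul_div_assoc, one_le_div hn]
    calc ‖N‖ ^ 2 ≤ ‖P - N‖ ^ 2 := by rw [hpyth]; exact le_add_of_nonneg_left (sq_nonneg _)
      _ ≤ (6 * (((n : ℝ) - k) / n)) ^ 3 * ‖P - N‖ ^ 2 :=
        le_mul_of_one_le_left (sq_nonneg _) (one_le_pow₀ this)

theorem frobeniusDist_psdCone_sq_le {M : Matrix (Fin n) (Fin n) ℝ} (hkn : k ≤ n)
    (hM : M ∈ kPSDClosure n k) :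
    frobeniusDist M (psdCone n) ^ 2 ≤ (6 * (((n : ℝ) - k) / n)) ^ 3 * ‖M‖ ^ 2 := by
  obtain ⟨P, N, hP, hN, rfl, hPN⟩ := exists_posSemidef_sub_posSemidef_mul_eq_zero
    ((conjTranspose_eq_transpose_of_trivial M).trans hM.1)
  refine le_trans ?_ (frobenius_norm_sq_le_of_sub_mem_kPSDClosure hP hN hPN hkn hM)
  have hdist : frobeniusDist (P - N) (psdCone n) ≤ ‖P - N - P‖ :=
    (frobeniusDist_psdCone_isGLB (P - N)).1 ⟨⟨P, hP⟩, rfl⟩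
  rw [sub_sub_cancel_left, norm_neg] at hdist
  exact pow_le_pow_left₀ (Real.iInf_nonneg fun _ => norm_nonneg _) hdist 2

end KPSDClosure

theorem theorem2_general (n k : ℕ) (hn : 0 < n) (hkn : k ≤ n) :
    normalizedFrobeniusDist (kPSDClosure n k) (psdCone n)
      ≤ 15 * (((n : ℝ) - (k : ℝ)) / (n : ℝ)) ^ (3 / 2 : ℝ) := by
  have hε : 0 ≤ ((n : ℝ) - k) / n :=
    div_nonneg (sub_nonneg.2 (by exact_mod_cast hkn)) n.cast_nonneg
  refine (normalizedFrobeniusDist_isLUB hn k).2 ?_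
  rintro _ ⟨M, hM, hM1, rfl⟩
  have hsq := frobeniusDist_psdCone_sq_le hkn hM
  rw [hM1, one_pow, mul_one, mul_pow] at hsq
  refine le_of_sq_le_sq (hsq.trans ?_) (by positivity)
  have hpow : ((((n : ℝ) - k) / n) ^ (3 / 2 : ℝ)) ^ 2 = (((n : ℝ) - k) / n) ^ 3 := by
    rw [← Real.rpow_mul_natCast hε]
    norm_num
  rw [mul_pow, hpow]
  gcongr
  norm_num

theorem theorem2 (n k : ℕ) (hn : 97 ≤ n) (hkn : k ≤ n) (hk : 3 * (n : ℝ) / 4 ≤ (k : ℝ)) :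
    normalizedFrobeniusDist (kPSDClosure n k) (psdCone n)
      ≤ 96 * (((n : ℝ) - (k : ℝ)) / (n : ℝ)) ^ (3 / 2 : ℝ) :=
  (theorem2_general n k (by omega) hkn).trans <| mul_le_mul_of_nonneg_right (by norm_num) <|
    Real.rpow_nonneg (div_nonneg (sub_nonneg.2 (Nat.cast_le.2 hkn)) n.cast_nonneg) _
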